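/- Let $\kappa\in\mathbb{R}$ and let $(X,d)$ be a complete CAT($\kappa$) space whose diameter is less than $\frac{\pi}{2\sqrt{\kappa}}$ if $\kappa>0$. Let $x,y,z\in X$ and let $\alpha,\beta\in(0,1)$ satisfy $\alpha+\beta=1$. Then there is exactly one point, denoted $\alpha x+\beta y$, that lies on a geodesic joining $x$ to $y$ at distance $\beta\, d(x,y)$ from $x$, and it satisfies \[ d^2(\alpha x+\beta y,\,z)\;\le\;\frac{\alpha\, d^2(x,z)+\beta\, d^2(y,z)}{\max\{\alpha,\beta\}}\;-\;\alpha\beta\, d^2(x,y). \] Here a geodesic joining $x$ to $y$ is an isometric embedding $\gamma\colon[0,d(x,y)]\to X$ with $\gamma(0)=x$ and $\gamma(d(x,y))=y$. Writing $D_\kappa=\pi/\sqrt{\kappa}$ for $\kappa>0$ and $D_\kappa=\infty$ for $\kappa\le 0$, the space $X$ is CAT($\kappa$) if any two points at distance less than $D_\kappa$ are joined by a geodesic and, for every geodesic triangle of perimeter less than $2D_\kappa$, the distance between any two points of the triangle is at most the distance between the corresponding points of a comparison triangle with the same side lengths in the simply connected complete surface of constant curvature $\kappa$. -/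

import Mathlib

/-- `γ`, restricted to `[0, dist x y]`, is a geodesic joining `x` to `y`: an isometric embedding of
that interval with `γ 0 = x` and `γ (dist x y) = y`. Values outside the interval are irrelevant. -/
structure IsGeodesic {X : Type*} [MetricSpace X] (γ : ℝ → X) (x y : X) : Prop where
  source : γ 0 = x
  target : γ (dist x y) = y
  isometry : ∀ s ∈ Set.Icc (0 : ℝ) (dist x y), ∀ t ∈ Set.Icc (0 : ℝ) (dist x y),
    dist (γ s) (γ t) = |s - t|

/-- `m` is a point `α x + β y` (for `α + β = 1`): it lies on a geodesic joining `x` to `y`, at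
distance `β * dist x y` from `x`. -/
def IsGeodesicCombination {X : Type*} [MetricSpace X] (α β : ℝ) (x y m : X) : Prop :=
  α + β = 1 ∧ ∃ γ : ℝ → X, IsGeodesic γ x y ∧ γ (β * dist x y) = m

/-- A geodesic triangle: vertices `v 0, v 1, v 2` (possibly coinciding) and, for each `i`, a choice
of geodesic `σ i` joining `v i` to `v (i + 1)` (indices modulo `3`). -/
def IsGeodesicTriangle {X : Type*} [MetricSpace X] (v : Fin 3 → X) (σ : Fin 3 → ℝ → X) : Prop :=
  ∀ i, IsGeodesic (σ i) (v i) (v (i + 1))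

/-- The perimeter of a triangle with vertices `v`. -/
noncomputable def perimeter {X : Type*} [MetricSpace X] (v : Fin 3 → X) : ℝ :=
  ∑ i, dist (v i) (v (i + 1))

/-- The triangle `(v, σ)` is no fatter than its comparison triangle `w` in the model plane `M` with
distance function `δ`: for all points `p = σ i s`, `q = σ j t` on its sides and all comparison
points `p'`, `q'` of them on the corresponding sides of `w`, `dist p q ≤ δ p' q'`.
A comparison point of `σ i s` is a point of the segment from `w i` to `w (i + 1)` at distance `s`
from `w i`, that is, a point at distances `s` and `dist (v i) (v (i + 1)) - s` from its ends. -/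
def ComparisonInequality {X : Type*} [MetricSpace X] (v : Fin 3 → X) (σ : Fin 3 → ℝ → X)
    (M : Type*) (δ : M → M → ℝ) : Prop :=
  ∀ w : Fin 3 → M, (∀ i, δ (w i) (w (i + 1)) = dist (v i) (v (i + 1))) →
    ∀ i j : Fin 3, ∀ s ∈ Set.Icc (0 : ℝ) (dist (v i) (v (i + 1))),
      ∀ t ∈ Set.Icc (0 : ℝ) (dist (v j) (v (j + 1))), ∀ p' q' : M,
        δ (w i) p' = s → δ p' (w (i + 1)) = dist (v i) (v (i + 1)) - s →
        δ (w j) q' = t → δ q' (w (j + 1)) = dist (v j) (v (j + 1)) - t →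
        dist (σ i s) (σ j t) ≤ δ p' q'

/-- The comparison inequality with respect to the model plane of constant curvature `κ`: the unit
sphere in `ℝ³` with its angular metric divided by `√κ` if `κ > 0`, the Euclidean plane if `κ = 0`,
and the hyperbolic plane with its metric divided by `√(-κ)` if `κ < 0`. -/
def SatisfiesCATInequality (κ : ℝ) {X : Type*} [MetricSpace X] (v : Fin 3 → X)
    (σ : Fin 3 → ℝ → X) : Prop :=
  (0 < κ → ComparisonInequality v σ (Metric.sphere (0 : EuclideanSpace ℝ (Fin 3)) 1)
    (fun a b => InnerProductGeometry.angle (a : EuclideanSpace ℝ (Fin 3)) b / √κ)) ∧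
  (κ = 0 → ComparisonInequality v σ (EuclideanSpace ℝ (Fin 2)) (fun a b => dist a b)) ∧
  (κ < 0 → ComparisonInequality v σ UpperHalfPlane (fun a b => dist a b / √(-κ)))

/-- `X` is a CAT(`κ`) space. With `D = π / √κ` if `κ > 0` and `D = ∞` if `κ ≤ 0`: any two points at
distance less than `D` are joined by a geodesic, and every geodesic triangle of perimeter less than
`2 * D` satisfies the comparison inequality in the model plane of curvature `κ`. -/
structure IsCATSpace (κ : ℝ) (X : Type*) [MetricSpace X] : Prop where
  exists_geodesic : ∀ x y : X, (0 < κ → dist x y < Real.pi / √κ) →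
    ∃ γ : ℝ → X, IsGeodesic γ x y
  comparison : ∀ (v : Fin 3 → X) (σ : Fin 3 → ℝ → X), IsGeodesicTriangle v σ →
    (0 < κ → perimeter v < 2 * (Real.pi / √κ)) → SatisfiesCATInequality κ v σ

/-! ### Spherical trigonometry -/

/-! Put `C = dist x y` and let `m` divide a geodesic from `x` to `y` into parts `t = βC` and `T =
αC`. By the CAT inequality, `dist m z` is at most the length `D` of the corresponding cevian in the
model plane, so only trigonometry remains. The cevian cuts the comparison triangle in two, with
angles of cosines `u` and `-u` at the foot. Bounding each outer side from below by a hinge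
inequality and adding with weights `T` and `t` cancels `u`.

For `κ ≤ 0` the hinge inequality is the Euclidean one. It gives Stewart's inequality, with constant
`1` in place of `1 / max α β` (`hyperbolic_cevian_sq_le`).

For `κ > 0` the Euclidean inequality fails, but it survives when the square of one adjacent side is
dropped (`spherical_hinge`). Dropping `t²` in one triangle and `D²` in the other leaves `D² ≤ (αA² +
βB²)/α - αβC²`, where `A`, `B` are the distances from the apex to the ends; by symmetry the same
holds with divisor `β`, whence the maximum.

Uniqueness is the same comparison with `z` the point at equal parameter on a second geodesic: the
cevian then has length zero. -/

theorem Real.mul_cos_le_sin {x : ℝ} (h0 : 0 ≤ x) (h1 : x ≤ Real.pi / 2) :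
    x * Real.cos x ≤ Real.sin x := by
  rcases h1.eq_or_lt with rfl | h1
  · simp
  · have hc : 0 < Real.cos x := Real.cos_pos_of_mem_Ioo ⟨by linarith, h1⟩
    have := Real.le_tan h0 h1
    rwa [Real.tan_eq_sin_div_cos, le_div_iff₀ hc] at this

/-- The tangent line inequality for the convex function `s ↦ cos √s`. -/
theorem Real.two_mul_cos_sub_cos_le {q r : ℝ} (hq0 : 0 ≤ q) (hq : q ≤ Real.pi / 2) (hr0 : 0 ≤ r)
    (hr : r ≤ Real.pi / 2) :
    2 * q * (Real.cos q - Real.cos r) ≤ (r ^ 2 - q ^ 2) * Real.sin q := by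
  have hpi := Real.pi_pos
  rcases le_total q r with hqr | hqr
  · obtain ⟨h, rfl⟩ : ∃ h, r = q + 2 * h := ⟨(r - q) / 2, by ring⟩
    have hh : 0 ≤ h := by linarith
    have e : Real.cos q - Real.cos (q + 2 * h) = 2 * Real.sin (q + h) * Real.sin h := by
      rw [Real.cos_sub_cos, show (q + (q + 2 * h)) / 2 = q + h by ring,
        show (q - (q + 2 * h)) / 2 = -h by ring, Real.sin_neg]
      ring
    have hsq : 0 ≤ Real.sin q := Real.sin_nonneg_of_nonneg_of_le_pi hq0 (by linarith)
    have hsh : 0 ≤ Real.sin h := Real.sin_nonneg_of_nonneg_of_le_pi hh (by linarith)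
    have hle : Real.sin h ≤ h := Real.sin_le hh
    have h1 : q * Real.sin (q + h) ≤ (q + h) * Real.sin q := by
      rw [Real.sin_add]
      have a1 : q * Real.sin q * Real.cos h ≤ q * Real.sin q * 1 :=
        mul_le_mul_of_nonneg_left (Real.cos_le_one h) (mul_nonneg hq0 hsq)
      have a2 : (q * Real.cos q) * Real.sin h ≤ Real.sin q * h :=
        mul_le_mul (Real.mul_cos_le_sin hq0 hq) hle hsh hsq
      linarith
    have h2 : (q * Real.sin (q + h)) * Real.sin h ≤ ((q + h) * Real.sin q) * h :=
      mul_le_mul h1 hle hsh (by positivity)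
    rw [e]
    linarith
  · obtain ⟨k, rfl⟩ : ∃ k, q = r + 2 * k := ⟨(q - r) / 2, by ring⟩
    have hk : 0 ≤ k := by linarith
    obtain ⟨m, rfl⟩ : ∃ m, r = m - k := ⟨r + k, by ring⟩
    have e : Real.cos (m - k + 2 * k) - Real.cos (m - k) = -(2 * Real.sin m * Real.sin k) := by
      rw [Real.cos_sub_cos, show (m - k + 2 * k + (m - k)) / 2 = m by ring,
        show (m - k + 2 * k - (m - k)) / 2 = k by ring]
      ring
    have hm : 0 ≤ m := by linarith
    have hsm : 0 ≤ Real.sin m := Real.sin_nonneg_of_nonneg_of_le_pi hm (by linarith)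
    have hsk : 0 ≤ Real.sin k := Real.sin_nonneg_of_nonneg_of_le_pi hk (by linarith)
    -- With `q = m + k`, `r = m - k` the claim is `m k sin (m + k) ≤ (m + k) sin m sin k`, which is
    -- the sum of these two inequalities.
    have a1 := mul_nonneg (mul_nonneg hm hsm)
      (sub_nonneg.2 (Real.mul_cos_le_sin hk (by linarith)))
    have a2 := mul_nonneg (mul_nonneg hk hsk)
      (sub_nonneg.2 (Real.mul_cos_le_sin hm (by linarith)))
    rw [e, show m - k + 2 * k = m + k by ring, Real.sin_add]
    nlinarith

/-- A lower bound for the side `r` of a spherical triangle with sides `p`, `q` enclosing an angle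
of cosine `u`. -/
theorem spherical_hinge {p q r u : ℝ} (hp0 : 0 < p) (hp : p ≤ Real.pi / 2) (hq0 : 0 < q)
    (hq : q ≤ Real.pi / 2) (hr0 : 0 ≤ r) (hr : r ≤ Real.pi / 2)
    (h : Real.cos r = Real.cos p * Real.cos q + Real.sin p * Real.sin q * u) :
    q ^ 2 - 2 * p * q * u ≤ r ^ 2 := by
  have hpi := Real.pi_pos
  have hsp : 0 < Real.sin p := Real.sin_pos_of_pos_of_lt_pi hp0 (by linarith)
  have hsq : 0 < Real.sin q := Real.sin_pos_of_pos_of_lt_pi hq0 (by linarith)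
  have hcq : 0 ≤ Real.cos q := Real.cos_nonneg_of_mem_Icc ⟨by linarith, hq⟩
  have hcr : 0 ≤ Real.cos r := Real.cos_nonneg_of_mem_Icc ⟨by linarith, hr⟩
  have hps : 0 ≤ p - Real.sin p := sub_nonneg.2 (Real.sin_le hp0.le)
  -- Equivalent to `cos q - cos r ≥ -p sin q · u`, which is then fed into the tangent line
  -- inequality.
  have key : 0 ≤ Real.cos q * (1 - Real.cos p) + Real.sin q * u * (p - Real.sin p) := by
    rcases le_total 0 u with hu | hu
    · exact add_nonneg (mul_nonneg hcq (sub_nonneg.2 (Real.cos_le_one p)))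
        (mul_nonneg (mul_nonneg hsq.le hu) hps)
    -- Eliminating `u` through `h`, `sin p` times the claim is `cos r (p - sin p) + cos q (sin p - p
    -- cos p)`.
    · refine nonneg_of_mul_nonneg_right ?_ hsp
      have h1 := mul_nonneg hcr hps
      have h2 := mul_nonneg hcq (sub_nonneg.2 (Real.mul_cos_le_sin hp0.le hp))
      rw [h] at h1
      linarith
  have ht := Real.two_mul_cos_sub_cos_le hq0.le hq hr0 hr
  rw [h] at ht
  have h3 := mul_nonneg hq0.le key
  have h4 : 0 ≤ Real.sin q * (r ^ 2 - (q ^ 2 - 2 * p * q * u)) := by linarith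
  linarith [nonneg_of_mul_nonneg_right h4 hsq]

/-- If `D` is the distance from a vertex of a small spherical triangle to the point dividing the
opposite side into parts `t`, `T`, then `D ^ 2` is bounded in terms of the other sides `A`, `B`. -/
theorem spherical_cevian_sq_le {A B D t T : ℝ} (hA0 : 0 ≤ A) (hA : A ≤ Real.pi / 2) (hB0 : 0 ≤ B)
    (hB : B ≤ Real.pi / 2) (hD0 : 0 < D) (hD : D ≤ Real.pi) (ht : 0 < t) (hT : 0 < T)
    (htT : t + T ≤ Real.pi / 2)
    (h : Real.cos D * Real.sin (t + T) = Real.cos A * Real.sin T + Real.cos B * Real.sin t) :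
    T * D ^ 2 ≤ T * A ^ 2 + t * B ^ 2 - t * T ^ 2 := by
  have hpi := Real.pi_pos
  have hst : 0 < Real.sin t := Real.sin_pos_of_pos_of_lt_pi ht (by linarith)
  have hsT : 0 < Real.sin T := Real.sin_pos_of_pos_of_lt_pi hT (by linarith)
  have hstT : 0 < Real.sin (t + T) := Real.sin_pos_of_pos_of_lt_pi (by linarith) (by linarith)
  have hcA : 0 ≤ Real.cos A := Real.cos_nonneg_of_mem_Icc ⟨by linarith, hA⟩
  have hcB : 0 ≤ Real.cos B := Real.cos_nonneg_of_mem_Icc ⟨by linarith, hB⟩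
  have hcD : 0 ≤ Real.cos D := by
    have : 0 ≤ Real.cos D * Real.sin (t + T) := by rw [h]; positivity
    exact nonneg_of_mul_nonneg_left this hstT
  have hD2 : D ≤ Real.pi / 2 := by
    by_contra! hlt
    exact absurd hcD (not_le.2 (Real.cos_neg_of_pi_div_two_lt_of_lt hlt (by linarith)))
  have hsD : 0 < Real.sin D := Real.sin_pos_of_pos_of_lt_pi hD0 (by linarith)
  -- `u` is the cosine of the angle at the foot, on the side of `A`; the supplementary angle faces
  -- `B`.
  obtain ⟨u, hu⟩ : ∃ u, Real.sin t * Real.sin D * u = Real.cos A - Real.cos t * Real.cos D :=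
    ⟨(Real.cos A - Real.cos t * Real.cos D) / (Real.sin t * Real.sin D), by field_simp⟩
  have h1 := spherical_hinge (u := u) ht (by linarith) hD0 hD2 hA0 hA (by linarith)
  have h2 := spherical_hinge (u := -u) hD0 hD2 hT (by linarith) hB0 hB (by
    refine mul_right_cancel₀ hst.ne' ?_
    rw [Real.sin_add] at h
    linear_combination (-1) * h + Real.sin T * hu)
  have h3 := mul_le_mul_of_nonneg_left h1 hT.le
  have h4 := mul_le_mul_of_nonneg_left h2 ht.le
  linarith

/-! ### Hyperbolic trigonometry -/

/-- The power series `∑ sⁿ / (2n)!` has convex terms on `s ≥ 0`. -/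
theorem Real.convexOn_cosh_sqrt : ConvexOn ℝ (Set.Ici 0) fun s : ℝ => Real.cosh √s := by
  refine ⟨convex_Ici 0, fun x hx y hy a b ha hb hab => ?_⟩
  have hs : ∀ s : ℝ, 0 ≤ s → HasSum (fun n : ℕ => s ^ n / ((2 * n).factorial : ℝ))
      (Real.cosh √s) := fun s hs => by
    simpa only [pow_mul, Real.sq_sqrt hs] using Real.hasSum_cosh √s
  have hx' : 0 ≤ x := hx
  have hy' : 0 ≤ y := hy
  refine hasSum_le (fun n => ?_) (hs (a • x + b • y) (by simp only [smul_eq_mul]; positivity))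
    (((hs x hx).mul_left a).add ((hs y hy).mul_left b))
  have := (convexOn_pow (𝕜 := ℝ) n).2 hx hy ha hb hab
  simp only [smul_eq_mul] at this ⊢
  rw [← mul_div_assoc, ← mul_div_assoc, ← add_div]
  gcongr

/-- A hyperbolic triangle with sides `p`, `q` enclosing an angle of cosine `u` has its third side
at least as long as in the Euclidean plane. -/
theorem hyperbolic_hinge {p q r u : ℝ} (hr : 0 ≤ r) (hu0 : -1 ≤ u) (hu1 : u ≤ 1)
    (h : Real.cosh r = Real.cosh p * Real.cosh q - Real.sinh p * Real.sinh q * u) :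
    p ^ 2 + q ^ 2 - 2 * p * q * u ≤ r ^ 2 := by
  -- With weights `(1 ± u) / 2`, `cosh r` averages `cosh (p - q)` and `cosh (p + q)`, while the
  -- Euclidean squared side averages `(p - q)²` and `(p + q)²`; this is Jensen.
  have hc := Real.convexOn_cosh_sqrt.2 (Set.mem_Ici.2 (sq_nonneg (p - q)))
    (Set.mem_Ici.2 (sq_nonneg (p + q))) (show 0 ≤ (1 + u) / 2 by linarith)
    (show 0 ≤ (1 - u) / 2 by linarith) (by ring)
  simp only [smul_eq_mul, Real.sqrt_sq_eq_abs, Real.cosh_abs] at hc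
  rw [Real.cosh_sub, Real.cosh_add,
    show (1 + u) / 2 * (p - q) ^ 2 + (1 - u) / 2 * (p + q) ^ 2 = p ^ 2 + q ^ 2 - 2 * p * q * u
      by ring] at hc
  have hle : Real.cosh √(p ^ 2 + q ^ 2 - 2 * p * q * u) ≤ Real.cosh r := by rw [h]; linarith
  rw [Real.cosh_le_cosh, abs_of_nonneg (Real.sqrt_nonneg _), abs_of_nonneg hr] at hle
  exact (Real.sqrt_le_left hr).1 hle

/-- The triangle inequalities say `cosh (A - C) ≤ cosh B ≤ cosh (A + C)`. Thus the cosine prescribed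
by the hyperbolic law of cosines lies in `[-1, 1]`. -/
theorem Real.abs_cosh_mul_cosh_sub_cosh_le {A B C : ℝ} (hA : 0 ≤ A) (hB : 0 ≤ B) (hC : 0 ≤ C)
    (hAB : A ≤ B + C) (hBC : B ≤ A + C) (hCA : C ≤ A + B) :
    |Real.cosh A * Real.cosh C - Real.cosh B| ≤ Real.sinh A * Real.sinh C := by
  have h1 : Real.cosh B ≤ Real.cosh (A + C) := by
    rw [Real.cosh_le_cosh, abs_of_nonneg hB, abs_of_nonneg (by positivity)]; exact hBC
  have h2 : Real.cosh (A - C) ≤ Real.cosh B := by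
    rw [Real.cosh_le_cosh, abs_of_nonneg hB, abs_le]; constructor <;> linarith
  rw [Real.cosh_add] at h1
  rw [Real.cosh_sub] at h2
  rw [abs_le]
  constructor <;> linarith

/-- Stewart's theorem holds as an inequality in the hyperbolic plane. -/
theorem hyperbolic_cevian_sq_le {A B D t T : ℝ} (hA0 : 0 ≤ A) (hB0 : 0 ≤ B) (hD0 : 0 < D)
    (ht : 0 < t) (hT : 0 < T) (hAD : A ≤ D + t) (hDA : D ≤ A + t) (htA : t ≤ A + D)
    (h : Real.cosh D * Real.sinh (t + T) = Real.cosh A * Real.sinh T + Real.cosh B * Real.sinh t) :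
    (t + T) * D ^ 2 ≤ T * A ^ 2 + t * B ^ 2 - t * T * (t + T) := by
  have hst : 0 < Real.sinh t := Real.sinh_pos_iff.2 ht
  have hsD : 0 < Real.sinh D := Real.sinh_pos_iff.2 hD0
  have hpos := mul_pos hsD hst
  obtain ⟨u, hu⟩ : ∃ u, u = (Real.cosh D * Real.cosh t - Real.cosh A) /
    (Real.sinh D * Real.sinh t) := ⟨_, rfl⟩
  have habs := Real.abs_cosh_mul_cosh_sub_cosh_le hD0.le hA0 ht.le hDA hAD (by linarith)
  have hu1 : |u| ≤ 1 := by rwa [hu, abs_div, abs_of_pos hpos, div_le_one hpos]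
  rw [eq_div_iff hpos.ne'] at hu
  obtain ⟨hl, hr⟩ := abs_le.1 hu1
  have h1 := hyperbolic_hinge (p := D) (q := t) hA0 hl hr (by linarith)
  have h2 := hyperbolic_hinge (p := D) (q := T) (u := -u) hB0 (by linarith) (by linarith) (by
    refine mul_right_cancel₀ hst.ne' ?_
    rw [Real.sinh_add] at h
    linear_combination (-1) * h - Real.sinh T * hu)
  have h3 := mul_le_mul_of_nonneg_left h1 hT.le
  have h4 := mul_le_mul_of_nonneg_left h2 ht.le
  linarith

/-! ### Comparison triangles in the model planes -/

/-- A great circle of the unit sphere. -/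
noncomputable def greatCircle (s : ℝ) : Metric.sphere (0 : EuclideanSpace ℝ (Fin 3)) 1 :=
  ⟨!₂[Real.cos s, Real.sin s, 0], by simp [EuclideanSpace.norm_eq, Fin.sum_univ_three]⟩

theorem sphere_angle_eq_arccos (a b : Metric.sphere (0 : EuclideanSpace ℝ (Fin 3)) 1) :
    InnerProductGeometry.angle (a : EuclideanSpace ℝ (Fin 3)) b =
      Real.arccos (inner ℝ (a : EuclideanSpace ℝ (Fin 3)) b) := by
  have ha : ‖(a : EuclideanSpace ℝ (Fin 3))‖ = 1 := by simp
  have hb : ‖(b : EuclideanSpace ℝ (Fin 3))‖ = 1 := by simp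
  simp [InnerProductGeometry.angle, ha, hb]

theorem angle_greatCircle {s t : ℝ} (hst : s ≤ t) (hts : t - s ≤ Real.pi) :
    InnerProductGeometry.angle (greatCircle s : EuclideanSpace ℝ (Fin 3)) (greatCircle t) =
      t - s := by
  rw [sphere_angle_eq_arccos, ← Real.arccos_cos (sub_nonneg.2 hst) hts, Real.cos_sub]
  congr 1
  simp [greatCircle, EuclideanSpace.inner_eq_star_dotProduct]

/-- The apex of a comparison triangle with base on the great circle, located by its distances to all
base points at once. `S` stands for `sin A` times the cosine of the base angle; it is later chosen
to give the third side its length. -/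
theorem exists_sphere_apex {A S : ℝ} (hS : S ^ 2 ≤ Real.sin A ^ 2) :
    ∃ w : Metric.sphere (0 : EuclideanSpace ℝ (Fin 3)) 1, ∀ s,
      InnerProductGeometry.angle (greatCircle s : EuclideanSpace ℝ (Fin 3)) w =
        Real.arccos (Real.cos A * Real.cos s + S * Real.sin s) := by
  have hs := Real.sq_sqrt (sub_nonneg.2 hS)
  refine ⟨⟨!₂[Real.cos A, S, √(Real.sin A ^ 2 - S ^ 2)], ?_⟩, fun s => ?_⟩
  · simp only [mem_sphere_iff_norm, sub_zero, EuclideanSpace.norm_eq, Fin.sum_univ_three,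
      Real.norm_eq_abs, sq_abs]
    simp [hs]
  · rw [sphere_angle_eq_arccos]
    congr 1
    simp [greatCircle, EuclideanSpace.inner_eq_star_dotProduct]

theorem Real.sq_cos_sub_cos_mul_cos_div_sin_le {A B C : ℝ} (hA0 : 0 ≤ A) (hA : A < Real.pi / 2)
    (hB0 : 0 ≤ B) (hB : B < Real.pi / 2) (hC0 : 0 < C) (hC : C < Real.pi / 2)
    (hAB : A ≤ B + C) (hBC : B ≤ A + C) (hCA : C ≤ A + B) :
    ((Real.cos B - Real.cos A * Real.cos C) / Real.sin C) ^ 2 ≤ Real.sin A ^ 2 := by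
  have hsA : 0 ≤ Real.sin A := Real.sin_nonneg_of_nonneg_of_le_pi hA0 (by linarith)
  have hsC : 0 < Real.sin C := Real.sin_pos_of_pos_of_lt_pi hC0 (by linarith)
  have h1 : Real.cos (A + C) ≤ Real.cos B :=
    Real.cos_le_cos_of_nonneg_of_le_pi hB0 (by linarith) hBC
  have h2 : Real.cos B ≤ Real.cos (A - C) := by
    rw [← Real.cos_abs (A - C)]
    exact Real.cos_le_cos_of_nonneg_of_le_pi (abs_nonneg _) (by linarith)
      (abs_le.2 ⟨by linarith, by linarith⟩)
  rw [Real.cos_add] at h1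
  rw [Real.cos_sub] at h2
  refine sq_le_sq.2 ?_
  rw [abs_div, abs_of_pos hsC, abs_of_nonneg hsA, div_le_iff₀ hsC, abs_le]
  constructor <;> linarith

/-- The geodesic of the upper half plane given by the imaginary axis. -/
noncomputable def imaginaryAxis (s : ℝ) : UpperHalfPlane := ⟨⟨0, Real.exp s⟩, Real.exp_pos s⟩

theorem dist_imaginaryAxis (s t : ℝ) : dist (imaginaryAxis s) (imaginaryAxis t) = |s - t| := by
  rw [UpperHalfPlane.dist_of_re_eq (show (imaginaryAxis s).re = (imaginaryAxis t).re from rfl)]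
  change dist (Real.log (Real.exp s)) (Real.log (Real.exp t)) = _
  rw [Real.log_exp, Real.log_exp, Real.dist_eq]

theorem exists_upperHalfPlane_apex {A S : ℝ} (hS : S ^ 2 ≤ Real.sinh A ^ 2) :
    ∃ w : UpperHalfPlane, ∀ s,
      Real.cosh (dist (imaginaryAxis s) w) = Real.cosh A * Real.cosh s - S * Real.sinh s := by
  have hs := Real.sq_sqrt (sub_nonneg.2 hS)
  have hpos : 0 < Real.cosh A - S := by
    have : S < Real.cosh A := lt_of_pow_lt_pow_left₀ 2 (Real.cosh_pos A).le
      (by rw [Real.cosh_sq]; linarith)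
    linarith
  -- The coordinates come from matching the coefficients of `exp s` and `exp (-s)` in the distance
  -- formula.
  refine ⟨⟨⟨√(Real.sinh A ^ 2 - S ^ 2) / (Real.cosh A - S), 1 / (Real.cosh A - S)⟩,
    by simpa using hpos⟩, fun s => ?_⟩
  rw [UpperHalfPlane.cosh_dist']
  change ((0 - √(Real.sinh A ^ 2 - S ^ 2) / (Real.cosh A - S)) ^ 2 + Real.exp s ^ 2 +
    (1 / (Real.cosh A - S)) ^ 2) / (2 * Real.exp s * (1 / (Real.cosh A - S))) = _
  have he := Real.exp_pos s
  rw [Real.cosh_eq s, Real.sinh_eq s, Real.exp_neg, zero_sub, neg_sq, div_pow, hs]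
  have hc := Real.cosh_sq A
  field_simp
  linear_combination (-1) * hc

/-- A coordinate axis of the Euclidean plane. -/
noncomputable def euclideanAxis (s : ℝ) : EuclideanSpace ℝ (Fin 2) := !₂[s, 0]

theorem dist_euclideanAxis (s t : ℝ) : dist (euclideanAxis s) (euclideanAxis t) = |s - t| := by
  simp [euclideanAxis, EuclideanSpace.dist_eq, Real.dist_eq, Real.sqrt_sq_eq_abs]

theorem exists_euclidean_apex {A S : ℝ} (hS : S ^ 2 ≤ A ^ 2) :
    ∃ w : EuclideanSpace ℝ (Fin 2), ∀ s,
      dist (euclideanAxis s) w ^ 2 = A ^ 2 - 2 * S * s + s ^ 2 := by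
  have hs := Real.sq_sqrt (sub_nonneg.2 hS)
  refine ⟨!₂[S, √(A ^ 2 - S ^ 2)], fun s => ?_⟩
  rw [EuclideanSpace.dist_eq, Real.sq_sqrt (by positivity)]
  simp [euclideanAxis, Real.dist_eq, hs]
  ring

/-! ### Comparison of a point on a side with the opposite vertex -/

/-- The vertex `z` enters as the point of parameter `0` on the third side, with comparison point `w`
itself. -/
theorem ComparisonInequality.dist_vertex_le {X : Type*} [MetricSpace X] {x y z : X}
    {γ γ₁ γ₂ : ℝ → X} {M : Type*} {δ : M → M → ℝ}
    (h : ComparisonInequality ![x, y, z] ![γ, γ₁, γ₂] M δ) (hγ₂ : γ₂ 0 = z) {a b w p : M} {s : ℝ}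
    (hab : δ a b = dist x y) (hbw : δ b w = dist y z) (hwa : δ w a = dist z x) (hw : δ w w = 0)
    (hs : s ∈ Set.Icc 0 (dist x y)) (hap : δ a p = s) (hpb : δ p b = dist x y - s) :
    dist (γ s) z ≤ δ p w := by
  have := h ![a, b, w] (by
    intro i
    fin_cases i
    · exact hab
    · exact hbw
    · exact hwa) 0 2 s hs 0 ⟨le_rfl, dist_nonneg⟩ p w hap hpb hw (by
      rw [sub_zero]; exact hwa)
  simpa [hγ₂] using this

/-- Every side is shorter than `D_κ / 2`, so the missing sides exist and the perimeter is below `2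
D_κ`. The side `γ` is prescribed, as uniqueness of geodesics is not yet known. -/
theorem IsCATSpace.exists_satisfiesCATInequality {X : Type*} [MetricSpace X] {κ : ℝ}
    (hX : IsCATSpace κ X) (hd : 0 < κ → ∀ p q : X, dist p q < Real.pi / (2 * √κ)) {x y : X}
    {γ : ℝ → X} (hγ : IsGeodesic γ x y) (z : X) :
    ∃ γ₁ γ₂ : ℝ → X, γ₂ 0 = z ∧ SatisfiesCATInequality κ ![x, y, z] ![γ, γ₁, γ₂] := by
  have hlt : 0 < κ → ∀ p q : X, dist p q < Real.pi / √κ / 2 := fun hκ p q => by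
    rw [div_div, mul_comm]; exact hd hκ p q
  have hpos : 0 < κ → 0 < Real.pi / √κ := fun hκ => div_pos Real.pi_pos (Real.sqrt_pos.2 hκ)
  obtain ⟨γ₁, h₁⟩ := hX.exists_geodesic y z fun hκ => by linarith [hlt hκ y z, hpos hκ]
  obtain ⟨γ₂, h₂⟩ := hX.exists_geodesic z x fun hκ => by linarith [hlt hκ z x, hpos hκ]
  refine ⟨γ₁, γ₂, h₂.source, hX.comparison _ _ ?_ fun hκ => ?_⟩
  · intro i
    fin_cases i
    · exact hγ
    · exact h₁
    · exact h₂
  · have : perimeter ![x, y, z] = dist x y + dist y z + dist z x := by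
      simp [perimeter, Fin.sum_univ_three]
    rw [this]
    linarith [hlt hκ x y, hlt hκ y z, hlt hκ z x, hpos hκ]

/-- The rescaled distance from a vertex to a point of the opposite side of a triangle is at most
the length `D` of the corresponding cevian in the unit sphere. -/
theorem IsCATSpace.exists_spherical_cevian {X : Type*} [MetricSpace X] {κ : ℝ}
    (hX : IsCATSpace κ X) (hκ : 0 < κ) (hd : ∀ p q : X, dist p q < Real.pi / (2 * √κ)) {x y : X}
    (hxy : x ≠ y) {γ : ℝ → X} (hγ : IsGeodesic γ x y) (z : X) {s : ℝ}
    (hs : s ∈ Set.Icc 0 (dist x y)) :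
    ∃ D, √κ * dist (γ s) z ≤ D ∧ D ≤ Real.pi ∧
      Real.cos D * Real.sin (√κ * dist x y) =
        Real.cos (√κ * dist x z) * Real.sin (√κ * dist x y - √κ * s) +
        Real.cos (√κ * dist y z) * Real.sin (√κ * s) := by
  obtain ⟨γ₁, γ₂, hγ₂, h, -, -⟩ := hX.exists_satisfiesCATInequality (fun _ => hd) hγ z
  have hk : 0 < √κ := Real.sqrt_pos.2 hκ
  have hlt : ∀ p q : X, √κ * dist p q < Real.pi / 2 := fun p q => by
    have := hd p q
    rw [lt_div_iff₀ (by positivity)] at this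
    linarith
  have hpi := Real.pi_pos
  have hC : 0 < √κ * dist x y := mul_pos hk (dist_pos.2 hxy)
  have hsC : 0 < Real.sin (√κ * dist x y) :=
    Real.sin_pos_of_pos_of_lt_pi hC (by linarith [hlt x y])
  have hs0 : 0 ≤ √κ * s := mul_nonneg hk.le hs.1
  have hs1 : √κ * s ≤ √κ * dist x y := mul_le_mul_of_nonneg_left hs.2 hk.le
  have htri : ∀ p q r : X, √κ * dist p q ≤ √κ * dist p r + √κ * dist r q := fun p q r => by
    rw [← mul_add]; exact mul_le_mul_of_nonneg_left (dist_triangle p r q) hk.le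
  have hS := Real.sq_cos_sub_cos_mul_cos_div_sin_le (A := √κ * dist x z) (B := √κ * dist y z)
    (by positivity) (hlt x z) (by positivity) (hlt y z) hC (hlt x y)
    (by linarith [htri x z y]) (by linarith [dist_comm x y ▸ htri y z x])
    (by have := htri x y z; rw [dist_comm z y] at this; exact this)
  obtain ⟨w, hw⟩ := exists_sphere_apex hS
  have hwB := hw (√κ * dist x y)
  rw [div_mul_cancel₀ _ hsC.ne', add_sub_cancel, Real.arccos_cos (by positivity)
    (by linarith [hlt y z])] at hwB
  have hwA := hw 0
  rw [Real.cos_zero, Real.sin_zero, mul_one, mul_zero, add_zero, Real.arccos_cos (by positivity)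
    (by linarith [hlt x z])] at hwA
  have hle := (h hκ).dist_vertex_le hγ₂ (a := greatCircle 0) (b := greatCircle (√κ * dist x y))
    (w := w) (p := greatCircle (√κ * s)) (s := s)
    (by rw [angle_greatCircle hC.le (by linarith [hlt x y]), sub_zero,
      mul_div_cancel_left₀ _ hk.ne'])
    (by rw [hwB, mul_div_cancel_left₀ _ hk.ne'])
    (by rw [InnerProductGeometry.angle_comm, hwA, mul_div_cancel_left₀ _ hk.ne', dist_comm])
    (by rw [InnerProductGeometry.angle_self (ne_zero_of_mem_unit_sphere w), zero_div]) hs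
    (by rw [angle_greatCircle hs0 (by linarith [hlt x y]), sub_zero,
      mul_div_cancel_left₀ _ hk.ne'])
    (by rw [angle_greatCircle hs1 (by linarith [hlt x y]), ← mul_sub,
      mul_div_cancel_left₀ _ hk.ne'])
  refine ⟨_, by rwa [le_div_iff₀ hk, mul_comm] at hle, InnerProductGeometry.angle_le_pi _ _, ?_⟩
  -- `Real.arccos` is clamped outside `[-1, 1]`; Cauchy–Schwarz and `hS` keep its argument inside.
  have hbound : |Real.cos (√κ * dist x z) * Real.cos (√κ * s) +
      (Real.cos (√κ * dist y z) - Real.cos (√κ * dist x z) * Real.cos (√κ * dist x y)) /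
        Real.sin (√κ * dist x y) * Real.sin (√κ * s)| ≤ 1 := by
    rw [← sq_le_one_iff_abs_le_one]
    generalize (Real.cos (√κ * dist y z) - Real.cos (√κ * dist x z) * Real.cos (√κ * dist x y)) /
        Real.sin (√κ * dist x y) = S at hS
    have h1 := Real.sin_sq_add_cos_sq (√κ * dist x z)
    have h2 := Real.sin_sq_add_cos_sq (√κ * s)
    nlinarith [sq_nonneg (Real.cos (√κ * dist x z) * Real.sin (√κ * s) - S * Real.cos (√κ * s))]
  rw [hw, Real.cos_arccos (abs_le.1 hbound).1 (abs_le.1 hbound).2, Real.sin_sub]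
  field_simp
  ring

theorem IsCATSpace.dist_sq_le_of_eq_zero {X : Type*} [MetricSpace X] (hX : IsCATSpace 0 X)
    {x y : X} (hxy : x ≠ y) {γ : ℝ → X} (hγ : IsGeodesic γ x y) (z : X) {s : ℝ}
    (hs : s ∈ Set.Icc 0 (dist x y)) :
    dist x y * dist (γ s) z ^ 2 ≤ (dist x y - s) * dist x z ^ 2 + s * dist y z ^ 2 -
      s * (dist x y - s) * dist x y := by
  obtain ⟨γ₁, γ₂, hγ₂, -, h, -⟩ :=
    hX.exists_satisfiesCATInequality (fun h => absurd h (lt_irrefl 0)) hγ z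
  have hC : 0 < dist x y := dist_pos.2 hxy
  have hS : ((dist x z ^ 2 + dist x y ^ 2 - dist y z ^ 2) / (2 * dist x y)) ^ 2 ≤
      dist x z ^ 2 := by
    rw [sq_le_sq, abs_div, abs_of_pos (by positivity : 0 < 2 * dist x y),
      abs_of_nonneg (dist_nonneg (x := x) (y := z)), div_le_iff₀ (by positivity), abs_le]
    have h1 := dist_triangle x z y
    have h2 := dist_triangle_left y z x
    have h3 := dist_triangle x y z
    rw [dist_comm z y] at h1
    have a1 := pow_le_pow_left₀ dist_nonneg h2 2
    have a2 : (dist x z - dist x y) ^ 2 ≤ dist y z ^ 2 :=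
      sq_le_sq.2 (abs_le_abs (by linarith) (by linarith))
    constructor <;> linarith
  obtain ⟨w, hw⟩ := exists_euclidean_apex hS
  have hwB := hw (dist x y)
  have hwA := hw 0
  rw [show dist x z ^ 2 - 2 * ((dist x z ^ 2 + dist x y ^ 2 - dist y z ^ 2) / (2 * dist x y)) *
    dist x y + dist x y ^ 2 = dist y z ^ 2 by field_simp; ring,
    pow_left_inj₀ dist_nonneg dist_nonneg two_ne_zero] at hwB
  rw [mul_zero, sub_zero, zero_pow two_ne_zero, add_zero,
    pow_left_inj₀ dist_nonneg dist_nonneg two_ne_zero] at hwA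
  have hle := (h rfl).dist_vertex_le hγ₂ (a := euclideanAxis 0) (b := euclideanAxis (dist x y))
    (w := w) (p := euclideanAxis s) (s := s)
    (by rw [dist_euclideanAxis, zero_sub, abs_neg, abs_of_pos hC]) hwB
    (by rw [dist_comm, hwA, dist_comm]) (dist_self w) hs
    (by rw [dist_euclideanAxis, zero_sub, abs_neg, abs_of_nonneg hs.1])
    (by rw [dist_euclideanAxis, abs_sub_comm, abs_of_nonneg (sub_nonneg.2 hs.2)])
  have hsq := mul_le_mul_of_nonneg_left (pow_le_pow_left₀ dist_nonneg hle 2) hC.le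
  rw [hw] at hsq
  refine hsq.trans_eq ?_
  field_simp
  ring

/-- `hz` makes the model cevian positive, as `hyperbolic_cevian_sq_le` needs in order to divide by
`sinh D`. -/
theorem IsCATSpace.dist_sq_le_of_neg {X : Type*} [MetricSpace X] {κ : ℝ} (hX : IsCATSpace κ X)
    (hκ : κ < 0) {x y : X} {γ : ℝ → X} (hγ : IsGeodesic γ x y) (z : X) {s : ℝ}
    (hs : s ∈ Set.Ioo 0 (dist x y)) (hz : γ s ≠ z) :
    dist x y * dist (γ s) z ^ 2 ≤ (dist x y - s) * dist x z ^ 2 + s * dist y z ^ 2 -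
      s * (dist x y - s) * dist x y := by
  obtain ⟨γ₁, γ₂, hγ₂, -, -, h⟩ :=
    hX.exists_satisfiesCATInequality (fun h => absurd h hκ.not_gt) hγ z
  obtain ⟨k, hk, hkκ⟩ : ∃ k, 0 < k ∧ √(-κ) = k := ⟨_, Real.sqrt_pos.2 (neg_pos.2 hκ), rfl⟩
  have h := h hκ
  rw [hkκ] at h
  have htri : ∀ p q r : X, k * dist p q ≤ k * dist p r + k * dist r q := fun p q r => by
    rw [← mul_add]; exact mul_le_mul_of_nonneg_left (dist_triangle p r q) hk.le
  have hC : 0 < k * dist x y := mul_pos hk (hs.1.trans hs.2)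
  have hsC := Real.sinh_pos_iff.2 hC
  have hs0 : 0 < k * s := mul_pos hk hs.1
  have hs1 : 0 < k * dist x y - k * s := by rw [← mul_sub]; exact mul_pos hk (sub_pos.2 hs.2)
  have hsA : 0 ≤ Real.sinh (k * dist x z) := Real.sinh_nonneg_iff.2 (by positivity)
  have hS : ((Real.cosh (k * dist x z) * Real.cosh (k * dist x y) - Real.cosh (k * dist y z)) /
      Real.sinh (k * dist x y)) ^ 2 ≤ Real.sinh (k * dist x z) ^ 2 := by
    rw [sq_le_sq, abs_div, abs_of_pos hsC, abs_of_nonneg hsA, div_le_iff₀ hsC]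
    refine Real.abs_cosh_mul_cosh_sub_cosh_le (by positivity) (by positivity) hC.le ?_ ?_ ?_
    · linarith [htri x z y]
    · have := htri y z x; rw [dist_comm y x] at this; linarith
    · have := htri x y z; rw [dist_comm z y] at this; linarith
  obtain ⟨w, hw⟩ := exists_upperHalfPlane_apex hS
  have hinj : ∀ {p q : ℝ}, 0 ≤ p → 0 ≤ q → Real.cosh p = Real.cosh q → p = q :=
    fun hp hq => Real.cosh_injOn hp hq
  have hwB := hw (k * dist x y)
  rw [div_mul_cancel₀ _ hsC.ne', sub_sub_cancel] at hwB
  replace hwB := hinj dist_nonneg (by positivity) hwB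
  have hwA := hw 0
  rw [Real.cosh_zero, Real.sinh_zero, mul_one, mul_zero, sub_zero] at hwA
  replace hwA := hinj dist_nonneg (by positivity) hwA
  have h0s : dist (imaginaryAxis 0) (imaginaryAxis (k * s)) = k * s := by
    rw [dist_imaginaryAxis, zero_sub, abs_neg, abs_of_pos hs0]
  have hle := h.dist_vertex_le hγ₂ (a := imaginaryAxis 0) (b := imaginaryAxis (k * dist x y))
    (w := w) (p := imaginaryAxis (k * s)) (s := s)
    (by rw [dist_imaginaryAxis, zero_sub, abs_neg, abs_of_pos hC, mul_div_cancel_left₀ _ hk.ne'])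
    (by rw [hwB, mul_div_cancel_left₀ _ hk.ne'])
    (by rw [dist_comm, hwA, mul_div_cancel_left₀ _ hk.ne', dist_comm])
    (by rw [dist_self, zero_div]) ⟨hs.1.le, hs.2.le⟩
    (by rw [h0s, mul_div_cancel_left₀ _ hk.ne'])
    (by rw [dist_imaginaryAxis, abs_sub_comm, abs_of_pos hs1, ← mul_sub,
      mul_div_cancel_left₀ _ hk.ne'])
  rw [le_div_iff₀ hk, mul_comm] at hle
  have hcev := hyperbolic_cevian_sq_le (A := k * dist x z) (B := k * dist y z)
    (D := dist (imaginaryAxis (k * s)) w) (t := k * s) (T := k * dist x y - k * s) (by positivity)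
    (by positivity) (lt_of_lt_of_le (mul_pos hk (dist_pos.2 hz)) hle) hs0 hs1
    (by rw [← hwA]; linarith [dist_triangle (imaginaryAxis 0) (imaginaryAxis (k * s)) w])
    (by rw [← hwA]; linarith [dist_triangle_left (imaginaryAxis (k * s)) w (imaginaryAxis 0)])
    (by
      rw [← hwA]
      linarith [dist_triangle_right (imaginaryAxis 0) (imaginaryAxis (k * s)) w])
    (by
      rw [add_sub_cancel, hw, Real.sinh_sub]
      field_simp
      ring)
  rw [add_sub_cancel] at hcev
  have hsq := mul_le_mul_of_nonneg_left (pow_le_pow_left₀ (by positivity) hle 2) hC.le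
  -- Both sides are homogeneous of degree three in the lengths, which were scaled by `k`.
  refine le_of_mul_le_mul_left ?_ (pow_pos hk 3)
  linarith

theorem IsCATSpace.dist_sq_le_of_nonpos {X : Type*} [MetricSpace X] {κ : ℝ} (hX : IsCATSpace κ X)
    (hκ : κ ≤ 0) {x y : X} {γ : ℝ → X} (hγ : IsGeodesic γ x y) (z : X) {s : ℝ}
    (hs : s ∈ Set.Ioo 0 (dist x y)) (hz : γ s ≠ z) :
    dist x y * dist (γ s) z ^ 2 ≤ (dist x y - s) * dist x z ^ 2 + s * dist y z ^ 2 -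
      s * (dist x y - s) * dist x y := by
  rcases hκ.eq_or_lt with rfl | hκ
  · exact hX.dist_sq_le_of_eq_zero (dist_pos.1 (hs.1.trans hs.2)) hγ z ⟨hs.1.le, hs.2.le⟩
  · exact hX.dist_sq_le_of_neg hκ hγ z hs hz

/-! ### Geodesic combinations -/

theorem IsGeodesic.dist_left {X : Type*} [MetricSpace X] {γ : ℝ → X} {x y : X}
    (hγ : IsGeodesic γ x y) {s : ℝ} (hs : s ∈ Set.Icc 0 (dist x y)) : dist x (γ s) = s := by
  have := hγ.isometry 0 ⟨le_rfl, dist_nonneg⟩ s hs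
  rwa [hγ.source, zero_sub, abs_neg, abs_of_nonneg hs.1] at this

theorem IsGeodesic.dist_right {X : Type*} [MetricSpace X] {γ : ℝ → X} {x y : X}
    (hγ : IsGeodesic γ x y) {s : ℝ} (hs : s ∈ Set.Icc 0 (dist x y)) :
    dist y (γ s) = dist x y - s := by
  have := hγ.isometry (dist x y) ⟨dist_nonneg, le_rfl⟩ s hs
  rwa [hγ.target, abs_of_nonneg (sub_nonneg.2 hs.2)] at this

theorem IsCATSpace.geodesic_unique {X : Type*} [MetricSpace X] {κ : ℝ} (hX : IsCATSpace κ X)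
    (hd : 0 < κ → ∀ p q : X, dist p q < Real.pi / (2 * √κ)) {x y : X} {γ γ' : ℝ → X}
    (hγ : IsGeodesic γ x y) (hγ' : IsGeodesic γ' x y) {s : ℝ} (hs : s ∈ Set.Ioo 0 (dist x y)) :
    γ s = γ' s := by
  have hs' : s ∈ Set.Icc 0 (dist x y) := ⟨hs.1.le, hs.2.le⟩
  have hpos := hs.1.trans hs.2
  by_contra hne
  have hdist := dist_pos.2 hne
  rcases le_or_gt κ 0 with hκ | hκ
  · have h := hX.dist_sq_le_of_nonpos hκ hγ (γ' s) hs hne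
    rw [hγ'.dist_left hs', hγ'.dist_right hs'] at h
    have : 0 < dist x y * dist (γ s) (γ' s) ^ 2 := by positivity
    linarith
  · obtain ⟨D, hD, hDpi, h⟩ :=
      hX.exists_spherical_cevian hκ (hd hκ) (dist_pos.1 hpos) hγ (γ' s) hs'
    have hk : 0 < √κ := Real.sqrt_pos.2 hκ
    have hlt := hd hκ x y
    rw [lt_div_iff₀ (by positivity)] at hlt
    have hsC : 0 < Real.sin (√κ * dist x y) :=
      Real.sin_pos_of_pos_of_lt_pi (by positivity) (by linarith [Real.pi_pos])
    -- The addition formula turns the right side into `sin (√κ · C)`, forcing `cos D = 1`.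
    rw [hγ'.dist_left hs', hγ'.dist_right hs', mul_sub, mul_comm (Real.cos (√κ * s)),
      ← Real.sin_add, sub_add_cancel, mul_eq_right₀ hsC.ne'] at h
    have hDpos : 0 < D := lt_of_lt_of_le (by positivity) hD
    have := Real.cos_lt_cos_of_nonneg_of_le_pi le_rfl hDpi hDpos
    rw [Real.cos_zero] at this
    linarith

/-- In a small space of curvature at most `κ > 0`, a weak form of Stewart's inequality. -/
theorem IsCATSpace.dist_sq_le_of_pos {X : Type*} [MetricSpace X] {κ : ℝ} (hX : IsCATSpace κ X)
    (hκ : 0 < κ) (hd : ∀ p q : X, dist p q < Real.pi / (2 * √κ)) {x y : X} {γ : ℝ → X}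
    (hγ : IsGeodesic γ x y) (z : X) {s : ℝ} (hs : s ∈ Set.Ioo 0 (dist x y)) (hz : γ s ≠ z) :
    (dist x y - s) * dist (γ s) z ^ 2 ≤ (dist x y - s) * dist x z ^ 2 + s * dist y z ^ 2 -
        s * (dist x y - s) ^ 2 ∧
      s * dist (γ s) z ^ 2 ≤ (dist x y - s) * dist x z ^ 2 + s * dist y z ^ 2 -
        (dist x y - s) * s ^ 2 := by
  obtain ⟨D, hD, hDpi, h⟩ := hX.exists_spherical_cevian hκ hd
    (dist_pos.1 (hs.1.trans hs.2)) hγ z ⟨hs.1.le, hs.2.le⟩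
  have hk : 0 < √κ := Real.sqrt_pos.2 hκ
  generalize √κ = k at *
  have hle : ∀ p q : X, k * dist p q ≤ Real.pi / 2 := fun p q => by
    have := hd p q
    rw [lt_div_iff₀ (by positivity)] at this
    linarith
  have hm : 0 < dist (γ s) z := dist_pos.2 hz
  have hDpos : 0 < D := lt_of_lt_of_le (by positivity) hD
  have ht : 0 < k * s := mul_pos hk hs.1
  have hT : 0 < k * dist x y - k * s := by rw [← mul_sub]; exact mul_pos hk (sub_pos.2 hs.2)
  have hsq : (k * dist (γ s) z) ^ 2 ≤ D ^ 2 := pow_le_pow_left₀ (by positivity) hD 2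
  have h1 := spherical_cevian_sq_le (A := k * dist x z) (B := k * dist y z) (by positivity)
    (hle x z) (by positivity) (hle y z) hDpos hDpi ht hT (by linarith [hle x y])
    (by rw [add_sub_cancel]; exact h)
  have h2 := spherical_cevian_sq_le (A := k * dist y z) (B := k * dist x z) (by positivity)
    (hle y z) (by positivity) (hle x z) hDpos hDpi hT ht (by linarith [hle x y])
    (by rw [sub_add_cancel]; linarith)
  have h3 := mul_le_mul_of_nonneg_left hsq hT.le
  have h4 := mul_le_mul_of_nonneg_left hsq ht.le
  constructor <;> refine le_of_mul_le_mul_left ?_ (pow_pos hk 3) <;> linarith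

theorem IsCATSpace.dist_geodesic_sq_le {X : Type*} [MetricSpace X] {κ : ℝ} (hX : IsCATSpace κ X)
    (hd : 0 < κ → ∀ p q : X, dist p q < Real.pi / (2 * √κ)) {x y : X} {γ : ℝ → X}
    (hγ : IsGeodesic γ x y) (z : X) {α β : ℝ} (hα : 0 < α) (hβ : 0 < β) (hαβ : α + β = 1) :
    dist (γ (β * dist x y)) z ^ 2 ≤
      (α * dist x z ^ 2 + β * dist y z ^ 2) / max α β - α * β * dist x y ^ 2 := by
  have hmax : 0 < max α β := lt_max_of_lt_left hα
  have hmax1 : max α β ≤ 1 := max_le (by linarith) (by linarith)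
  have hdiv : α * dist x z ^ 2 + β * dist y z ^ 2 ≤
      (α * dist x z ^ 2 + β * dist y z ^ 2) / max α β :=
    le_div_self (by positivity) hmax hmax1
  rcases eq_or_ne x y with rfl | hxy
  · rw [dist_self, mul_zero, hγ.source]
    rw [← add_mul, hαβ] at hdiv ⊢
    linarith
  have hC := dist_pos.2 hxy
  have hs : β * dist x y ∈ Set.Ioo 0 (dist x y) :=
    ⟨by positivity, mul_lt_of_lt_one_left hC (by linarith)⟩
  have hT : dist x y - β * dist x y = α * dist x y := by
    linear_combination (-dist x y) * hαβ
  -- Here the cevian degenerates, and `α(βC)² + β(αC)² = αβC²` is used directly.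
  by_cases hz : γ (β * dist x y) = z
  · have hl := hγ.dist_left ⟨hs.1.le, hs.2.le⟩
    have hr := hγ.dist_right ⟨hs.1.le, hs.2.le⟩
    rw [hz] at hl hr
    rw [hT] at hr
    rw [hz, dist_self, hl, hr]
    rw [hl, hr] at hdiv
    have : α * (β * dist x y) ^ 2 + β * (α * dist x y) ^ 2 = (α + β) * (α * β * dist x y ^ 2) := by
      ring
    rw [hαβ, one_mul] at this
    linarith
  rcases le_or_gt κ 0 with hκ | hκ
  · have h := hX.dist_sq_le_of_nonpos hκ hγ z hs hz
    rw [hT] at h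
    refine le_trans (le_of_mul_le_mul_left ?_ hC) (sub_le_sub_right hdiv _)
    linarith
  · obtain ⟨h1, h2⟩ := hX.dist_sq_le_of_pos hκ (hd hκ) hγ z hs hz
    rw [hT] at h1 h2
    rw [le_sub_iff_add_le, le_div_iff₀ hmax]
    refine le_of_mul_le_mul_left ?_ hC
    -- `h1` is the bound with divisor `α`, `h2` the one with divisor `β`.
    rcases max_choice α β with hm | hm <;> rw [hm] <;> linarith

theorem lemma2 {X : Type*} [MetricSpace X] [CompleteSpace X] (κ : ℝ) (hX : IsCATSpace κ X)
    (hdiam : 0 < κ → Metric.ediam (Set.univ : Set X) < ENNReal.ofReal (Real.pi / (2 * √κ)))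
    (x y z : X) (α β : ℝ) (hα : α ∈ Set.Ioo (0 : ℝ) 1) (hβ : β ∈ Set.Ioo (0 : ℝ) 1)
    (hαβ : α + β = 1) :
    (∃! m : X, IsGeodesicCombination α β x y m) ∧
    ∀ m : X, IsGeodesicCombination α β x y m →
      dist m z ^ 2 ≤
        (α * dist x z ^ 2 + β * dist y z ^ 2) / max α β - α * β * dist x y ^ 2 := by
  have hd : 0 < κ → ∀ p q : X, dist p q < Real.pi / (2 * √κ) := fun hκ p q => by
    have hpos : 0 < Real.pi / (2 * √κ) :=
      div_pos Real.pi_pos (mul_pos two_pos (Real.sqrt_pos.2 hκ))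
    have := (Metric.edist_le_ediam_of_mem (Set.mem_univ p) (Set.mem_univ q)).trans_lt (hdiam hκ)
    rwa [edist_dist, ENNReal.ofReal_lt_ofReal_iff hpos] at this
  refine ⟨?_, ?_⟩
  · obtain ⟨γ, hγ⟩ := hX.exists_geodesic x y fun hκ => (hd hκ x y).trans_le
      (div_le_div_of_nonneg_left Real.pi_pos.le (Real.sqrt_pos.2 hκ)
        (by linarith [Real.sqrt_nonneg κ]))
    refine ⟨γ (β * dist x y), ⟨hαβ, γ, hγ, rfl⟩, ?_⟩
    rintro _ ⟨-, γ', hγ', rfl⟩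
    rcases eq_or_ne x y with rfl | hxy
    · rw [dist_self, mul_zero, hγ.source, hγ'.source]
    · have hC := dist_pos.2 hxy
      exact hX.geodesic_unique hd hγ' hγ ⟨mul_pos hβ.1 hC, mul_lt_of_lt_one_left hC hβ.2⟩
  · rintro _ ⟨-, γ, hγ, rfl⟩
    exact hX.dist_geodesic_sq_le hd hγ z hα.1 hβ.1 hαβ
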